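/- An ideal on a countable set $X$ is a family $\mathcal I\subseteq\mathcal P(X)$ closed under finite unions and subsets, containing all finite subsets of $X$, with $X\notin\mathcal I$. A submeasure is a map $\phi:\mathcal P(\omega)\to[0,\infty]$ with $\phi(\emptyset)=0$, $\phi(\{n\})<\infty$ for all $n$, and $\phi(A)\le\phi(A\cup B)\le\phi(A)+\phi(B)$ for all $A,B$; it is lower semicontinuous if $\phi(A)=\lim_n\phi(A\cap\{0,\dots,n-1\})$ for all $A$, and non-pathological if $\phi(A)=\sup\{\mu(A):\mu\text{ is a measure on }\omega,\ \mu(B)\le\phi(B)\text{ for all }B\subseteq\omega\}$ for all $A$. A $\mathbf{\Sigma}^0_2$ ideal on $\omega$ (i.e. one that is $F_\sigma$ in $\mathcal P(\omega)\cong 2^\omega$) is non-pathological if it is of the form $\mathrm{Fin}(\phi)=\{A\subseteq\omega:\phi(A)<\infty\}$ for some non-pathological lower semicontinuous submeasure $\phi$. For an ideal $\mathcal I$ on $\omega$ and real-valued functions on a set $X$, $(f_n)_{n\in\omega}$ is $\mathcal I$-pointwise convergent to $f$ if $\{n: f_n(x)\notin U\}\in\mathcal I$ for every $x\in X$ and every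 open $U\ni f(x)$, and $\mathcal I$-uniformly convergent to $f$ if $\{n:\exists x\in X\ |f_n(x)-f(x)|\ge\varepsilon\}\in\mathcal I$ for every $\varepsilon>0$. Ideals $\mathcal I$ on $X$ and $\mathcal J$ on $Y$ are isomorphic if there is a bijection $h:Y\to X$ with $A\in\mathcal I\Leftrightarrow h^{-1}[A]\in\mathcal J$ for all $A\subseteq X$. Let $\mathrm{Fin}$ be the ideal of finite subsets of $\omega$; let $\mathrm{Fin}\oplus\mathcal P(\omega)$ consist of all subsets of $(\{0\}\times\omega)\cup(\{1\}\times\omega)$ with finite section at $0$; and let $\mathrm{Fin}\otimes\{\emptyset\}$ consist of all $M\subseteq\omega\times\omega$ with only finitely many nonempty vertical sections $\{x:(s,x)\in M\}$. Let $\mathrm{non}(\mathcal N)$ be the least cardinality of a non-Lebesgue-null set of reals, and $\mathfrak b$ the least cardinality of a subset of $\omega^\omega$ that is unbounded in the order of eventual domination. **Corollary.** Let $\mathcal I$ be a non-pathological $\mathbf{\Sigma}^0_2$ ideal on $\omega$. Consider the conditions: (a) $\mathcal I$ is Egorov in the sense of Kadets and Leonov: for every finite measure space $(X,\mathcal M,\mu)$,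 every $\eta>0$ and every sequence $(f_n)$ of measurable functions $X\to\mathbb R$ that is $\mathcal I$-pointwise convergent to a measurable $f:X\to\mathbb R$, there is $M\in\mathcal M$ with $\mu(X\setminus M)\le\eta$ such that $(f_n\restriction M)$ is $\mathcal I$-uniformly convergent to $f\restriction M$; (b) $\mathcal I$ is generalized Egorov in the sense of Korch and Repický: for every $\eta>0$ and every sequence $(f_n)$ of (not necessarily measurable) functions $[0,1]\to\mathbb R$ that is $\mathcal I$-pointwise convergent to a (not necessarily measurable) $f:[0,1]\to\mathbb R$, there is $M\subseteq[0,1]$ with Lebesgue outer measure $\lambda^\star(M)\ge 1-\eta$ such that $(f_n\restriction M)$ is $\mathcal I$-uniformly convergent to $f\restriction M$; (c) $\mathcal I$ is countably generated: there is a countable $\mathcal A\subseteq\mathcal I$ such that each $B\in\mathcal I$ is contained in the union of a finite subfamily of $\mathcal A$; (d) $\mathcal I$ is isomorphic to $\mathrm{Fin}$, $\mathrm{Fin}\oplus\mathcal P(\omega)$ or $\mathrm{Fin}\otimes\{\emptyset\}$. Then (a), (c) and (d) are equivalent, and (b) implies (c). If $\mathrm{non}(\mathcal N)<\mathfrak b$,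 then all four conditions (a), (b), (c) and (d) are equivalent. -/

import Mathlib

open Set Filter Topology MeasureTheory
open scoped ENNReal

universe u

/-- An ideal on a set `X`: a family of subsets closed under finite unions and subsets, containing
all finite sets and not containing `X` itself. -/
@[ext]
structure SetIdeal (X : Type*) where
  sets : Set (Set X)
  union_mem : ∀ A B : Set X, A ∈ sets → B ∈ sets → A ∪ B ∈ sets
  subset_mem : ∀ A B : Set X, A ⊆ B → B ∈ sets → A ∈ sets
  finite_mem : ∀ A : Set X, A.Finite → A ∈ sets
  univ_notMem : (Set.univ : Set X) ∉ sets

namespace SetIdeal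

/-- `I` is generated by a countable family `𝒜 ⊆ I`: every member of `I` is covered by finitely
many members of `𝒜`. -/
def IsCountablyGenerated {X : Type*} (I : SetIdeal X) : Prop :=
  ∃ 𝒜 : Set (Set X), 𝒜.Countable ∧ 𝒜 ⊆ I.sets ∧
    ∀ B ∈ I.sets, ∃ 𝒜' : Set (Set X), 𝒜' ⊆ 𝒜 ∧ 𝒜'.Finite ∧ B ⊆ ⋃₀ 𝒜'

/-- Isomorphism of ideals on `X` and `Y`. -/
def IsIsomorphic {X Y : Type*} (I : SetIdeal X) (J : SetIdeal Y) : Prop :=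
  ∃ f : Y ≃ X, ∀ A : Set X, A ∈ I.sets ↔ f ⁻¹' A ∈ J.sets

/-- The ideal `Fin` of all finite subsets of `ω`. -/
def finiteIdeal : SetIdeal ℕ where
  sets := {A | A.Finite}
  union_mem := fun _ _ hA hB => Set.Finite.union hA hB
  subset_mem := fun _ _ h hB => Set.Finite.subset hB h
  finite_mem := fun _ h => h
  univ_notMem := fun h => Set.infinite_univ h

/-- The ideal `I ⊕ 𝒫(ω)` on the disjoint sum of `S` and `ω`. -/
def sumPowerset {S : Type*} (I : SetIdeal S) : SetIdeal (S ⊕ ℕ) where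
  sets := {M | Sum.inl ⁻¹' M ∈ I.sets}
  union_mem := fun _ _ hA hB => I.union_mem _ _ hA hB
  subset_mem := fun _ _ h hB => I.subset_mem _ _ (Set.preimage_mono h) hB
  finite_mem := fun _ h => I.finite_mem _ (h.preimage Sum.inl_injective.injOn)
  univ_notMem := fun h => I.univ_notMem h

/-- The ideal `I ⊗ {∅}` on `S × ω`: the sets `M` with only `I`-many nonempty vertical
sections. -/
def prodEmpty {S : Type*} (I : SetIdeal S) : SetIdeal (S × ℕ) where
  sets := {M | {s : S | {x : ℕ | (s, x) ∈ M} ≠ ∅} ∈ I.sets}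
  union_mem := by
    intro A B hA hB
    refine I.subset_mem _ _ ?_ (I.union_mem _ _ hA hB)
    intro s hs
    obtain ⟨x, hx⟩ := Set.nonempty_iff_ne_empty.mpr hs
    rcases hx with hx | hx
    · exact Or.inl (Set.nonempty_iff_ne_empty.mp ⟨x, hx⟩)
    · exact Or.inr (Set.nonempty_iff_ne_empty.mp ⟨x, hx⟩)
  subset_mem := by
    intro A B h hB
    refine I.subset_mem _ _ ?_ hB
    intro s hs
    obtain ⟨x, hx⟩ := Set.nonempty_iff_ne_empty.mpr hs
    exact Set.nonempty_iff_ne_empty.mp ⟨x, h hx⟩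
  finite_mem := by
    intro A hA
    refine I.finite_mem _ ((hA.image Prod.fst).subset ?_)
    intro s hs
    obtain ⟨x, hx⟩ := Set.nonempty_iff_ne_empty.mpr hs
    exact ⟨(s, x), hx, rfl⟩
  univ_notMem := by
    intro h
    refine I.univ_notMem (I.subset_mem _ _ ?_ h)
    intro s _
    exact Set.nonempty_iff_ne_empty.mp ⟨0, Set.mem_univ _⟩

/-- `I` is a `Σ⁰₂` (that is, `F_σ`) subset of `𝒫(ω)`, identified with the Cantor space `2^ω`. -/
def IsSigma02 (I : SetIdeal ℕ) : Prop :=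
  ∃ F : ℕ → Set (ℕ → Bool), (∀ k, IsClosed (F k)) ∧
    {x : ℕ → Bool | {n | x n = true} ∈ I.sets} = ⋃ k, F k

end SetIdeal

/-- Submeasures on `ω`. -/
structure IsSubmeasure (φ : Set ℕ → ℝ≥0∞) : Prop where
  empty : φ ∅ = 0
  singleton_lt_top : ∀ n : ℕ, φ {n} < ∞
  le_union : ∀ A B : Set ℕ, φ A ≤ φ (A ∪ B)
  union_le : ∀ A B : Set ℕ, φ (A ∪ B) ≤ φ A + φ B

/-- Lower semicontinuity of a submeasure: `φ(A) = lim φ(A ∩ n)`, where `n = {0, …, n - 1}`. -/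
def IsLscSubmeasure (φ : Set ℕ → ℝ≥0∞) : Prop :=
  ∀ A : Set ℕ, Tendsto (fun n : ℕ => φ (A ∩ Set.Iio n)) atTop (𝓝 (φ A))

/-- A submeasure is non-pathological if it is the pointwise supremum of the measures below it. -/
def IsNonPathologicalSubmeasure (φ : Set ℕ → ℝ≥0∞) : Prop :=
  ∀ A : Set ℕ, φ A = ⨆ (μ : Measure ℕ) (_ : ∀ B : Set ℕ, μ B ≤ φ B), μ A

namespace SetIdeal

/-- Non-pathological `Σ⁰₂` ideals: those of the form `Fin(φ) = {A : φ(A) < ∞}` for a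
non-pathological lower semicontinuous submeasure `φ`. -/
def IsNonPathologicalSigma02 (I : SetIdeal ℕ) : Prop :=
  I.IsSigma02 ∧ ∃ φ : Set ℕ → ℝ≥0∞, IsSubmeasure φ ∧ IsLscSubmeasure φ ∧
    IsNonPathologicalSubmeasure φ ∧ I.sets = {A | φ A < ∞}

/-- `I`-convergence of a sequence in a topological space. -/
def ConvergesTo {Y : Type*} [TopologicalSpace Y] (I : SetIdeal ℕ) (x : ℕ → Y) (a : Y) : Prop :=
  ∀ U : Set Y, IsOpen U → a ∈ U → {n | x n ∉ U} ∈ I.sets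

/-- `I`-pointwise convergence of real functions. -/
def PointwiseConvergesTo {X : Type*} (I : SetIdeal ℕ) (f : ℕ → X → ℝ) (g : X → ℝ) : Prop :=
  ∀ x : X, I.ConvergesTo (fun n => f n x) (g x)

/-- `I`-uniform convergence of real functions. -/
def UniformlyConvergesTo {X : Type*} (I : SetIdeal ℕ) (f : ℕ → X → ℝ) (g : X → ℝ) : Prop :=
  ∀ ε : ℝ, 0 < ε → {n | ∃ x : X, ε ≤ |f n x - g x|} ∈ I.sets

/-- Egorov ideals in the sense of Kadets and Leonov: the ideal Egorov theorem holds on every finite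
measure space. -/
def IsKadetsLeonovEgorov (I : SetIdeal ℕ) : Prop :=
  ∀ (X : Type u) [MeasurableSpace X] (μ : Measure X) [IsFiniteMeasure μ] (η : ℝ)
    (f : ℕ → X → ℝ) (g : X → ℝ), 0 < η → (∀ n, Measurable (f n)) → Measurable g →
    I.PointwiseConvergesTo f g →
    ∃ M : Set X, MeasurableSet M ∧ μ Mᶜ ≤ ENNReal.ofReal η ∧
      I.UniformlyConvergesTo (fun n => M.domRestrict (f n)) (M.domRestrict g)

/-- Generalized Egorov ideals in the sense of Korch and Repický: arbitrary, possibly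
non-measurable, functions on `[0,1]`. The value of `volume` at an arbitrary subset of `ℝ` is its
Lebesgue outer measure. -/
def IsGeneralizedEgorov (I : SetIdeal ℕ) : Prop :=
  ∀ (η : ℝ) (f : ℕ → Set.Icc (0 : ℝ) 1 → ℝ) (g : Set.Icc (0 : ℝ) 1 → ℝ), 0 < η →
    I.PointwiseConvergesTo f g →
    ∃ M : Set (Set.Icc (0 : ℝ) 1),
      ENNReal.ofReal (1 - η) ≤ volume ((fun x : Set.Icc (0 : ℝ) 1 => (x : ℝ)) '' M) ∧
      I.UniformlyConvergesTo (fun n => M.domRestrict (f n)) (M.domRestrict g)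

end SetIdeal

/-- `non(𝒩)`: the least cardinality of a set of reals that is not Lebesgue null. -/
noncomputable def nonNull : Cardinal.{0} :=
  sInf {κ | ∃ A : Set ℝ, volume A ≠ 0 ∧ Cardinal.mk A = κ}

/-- The bounding number `𝔟`: the least cardinality of a family in `ω^ω` that is not bounded with
respect to eventual domination. -/
noncomputable def boundingNumber : Cardinal.{0} :=
  sInf {κ | ∃ F : Set (ℕ → ℕ),
    (¬ ∃ g : ℕ → ℕ, ∀ f ∈ F, ∀ᶠ n in atTop, f n ≤ g n) ∧ Cardinal.mk F = κ}

/-! A countably generated ideal has an increasing cofinal sequence `A`. If all `A n` are finite, the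
ideal is `Fin`; otherwise the differences `A m \ A n` are eventually all finite, or infinitely often
infinite along a subsequence, which gives the other two models. Egorov's classical proof runs with
the complements of the `A n` as tails. Without measurability, assign to each point its modulus of
convergence in `ω^ω`: on a non-null set of size below `𝔟` these moduli have a common bound.

For the converse, suppose `Fin(φ)` is not countably generated. Some level `{φ ≤ k}` is then not
countably covered, and the finite initial segments whose cylinders are not countably covered form a
tree in which the extensions of each node `t` have union of infinite `φ`-value
(`LargeNode.succs_notMem`). Non-pathologicality gives a random point `q t` of that union lying in
`W` with probability at most `ε t * φ W`. Following these choices yields a random branch `C u`, of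
`φ`-value at most `k` by lower semicontinuity. The functions `u ↦ 1_{n ∈ C u}` converge
`I`-pointwise to `0`. If they converge `I`-uniformly on `M`, then `W = ⋃_{u ∈ M} C u` has finite
`φ`-value. As a branch leaves every finite set of nodes, `M` is covered by a tail of the events `q t
∈ W`, whose probabilities are summable, so `M` has outer measure below `1/2`
(`exists_not_uniformlyConvergesTo`). -/

namespace SetIdeal

/-! ### Countably generated ideals and their classification. -/

lemma iUnion_le_mem {X : Type*} (I : SetIdeal X) {A : ℕ → Set X} (hA : ∀ n, A n ∈ I.sets) (n : ℕ) :
    (⋃ i ≤ n, A i) ∈ I.sets := by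
  induction n with
  | zero => simpa using hA 0
  | succ n ih =>
    refine I.subset_mem _ _ ?_ (I.union_mem _ _ ih (hA (n + 1)))
    intro x hx
    simp only [mem_iUnion, exists_prop] at hx
    obtain ⟨i, hi, hx⟩ := hx
    rcases Nat.le_succ_iff.mp hi with h | h
    · exact Or.inl (mem_biUnion (x := i) h hx)
    · subst h; exact Or.inr hx

/-- A countably generated ideal has an increasing cofinal sequence. -/
lemma isCountablyGenerated_iff {X : Type*} (I : SetIdeal X) :
    I.IsCountablyGenerated ↔
      ∃ A : ℕ → Set X, Monotone A ∧ ∀ B, B ∈ I.sets ↔ ∃ n, B ⊆ A n := by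
  constructor
  · rintro ⟨𝒜, hc, hI, hgen⟩
    -- Adding `∅` makes the family nonempty, hence enumerable by `ℕ`.
    obtain ⟨e, he⟩ := (hc.insert ∅).exists_eq_range (insert_nonempty _ _)
    have heI : ∀ n, e n ∈ I.sets := by
      intro n
      have h : e n ∈ insert ∅ 𝒜 := he ▸ mem_range_self n
      rcases h with h | h
      · rw [h]; exact I.finite_mem _ finite_empty
      · exact hI h
    refine ⟨fun n => ⋃ i ≤ n, e i,
      fun m n hmn => biUnion_subset_biUnion_left fun i (hi : i ≤ m) => hi.trans hmn, fun B =>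
      ⟨fun hB => ?_, fun ⟨n, hn⟩ => I.subset_mem _ _ hn (I.iUnion_le_mem heI n)⟩⟩
    obtain ⟨𝒜', hsub, hfin, hB⟩ := hgen B hB
    have hex : ∀ S ∈ 𝒜', ∃ n, e n = S := fun S hS => by
      have h : S ∈ insert ∅ 𝒜 := Or.inr (hsub hS)
      rwa [he] at h
    choose! k hk using hex
    obtain ⟨N, hN⟩ := (hfin.image k).bddAbove
    refine ⟨N, hB.trans ?_⟩
    rintro x ⟨S, hS, hx⟩
    exact mem_biUnion (x := k S) (hN (mem_image_of_mem k hS)) (by rwa [hk S hS])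
  · rintro ⟨A, -, hA⟩
    refine ⟨range A, countable_range A, ?_, fun B hB => ?_⟩
    · rintro _ ⟨n, rfl⟩
      exact (hA _).mpr ⟨n, Subset.rfl⟩
    · obtain ⟨n, hn⟩ := (hA B).mp hB
      exact ⟨{A n}, by simp, finite_singleton _, by simpa using hn⟩

lemma IsIsomorphic.isCountablyGenerated {X Y : Type*} {I : SetIdeal X} {J : SetIdeal Y}
    (h : I.IsIsomorphic J) (hJ : J.IsCountablyGenerated) : I.IsCountablyGenerated := by
  rw [isCountablyGenerated_iff] at hJ ⊢
  obtain ⟨f, hf⟩ := h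
  obtain ⟨A, hmono, hA⟩ := hJ
  refine ⟨fun n => f '' A n, fun m n hmn => image_mono (hmono hmn), fun B => ?_⟩
  rw [hf, hA]
  exact exists_congr fun n => by rw [← f.preimage_subset B, f.preimage_image]

lemma finiteIdeal_isCountablyGenerated : finiteIdeal.IsCountablyGenerated := by
  rw [isCountablyGenerated_iff]
  refine ⟨Iic, monotone_Iic, fun B => ⟨fun hB => ?_, fun ⟨n, hn⟩ => (finite_Iic n).subset hn⟩⟩
  exact (show B.Finite from hB).bddAbove

lemma IsCountablyGenerated.sumPowerset {S : Type*} {I : SetIdeal S} (h : I.IsCountablyGenerated) :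
    I.sumPowerset.IsCountablyGenerated := by
  rw [isCountablyGenerated_iff] at h ⊢
  obtain ⟨A, hmono, hA⟩ := h
  refine ⟨fun n => Sum.inl '' A n ∪ range Sum.inr,
    fun m n hmn => union_subset_union_left _ (image_mono (hmono hmn)), fun B => ?_⟩
  refine (hA _).trans (exists_congr fun n => ⟨fun h => ?_, fun h x hx => ?_⟩)
  · rintro (x | x) hx
    · exact Or.inl ⟨x, h hx, rfl⟩
    · exact Or.inr ⟨x, rfl⟩
  · simpa using h hx

lemma IsCountablyGenerated.prodEmpty {S : Type*} {I : SetIdeal S} (h : I.IsCountablyGenerated) :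
    I.prodEmpty.IsCountablyGenerated := by
  rw [isCountablyGenerated_iff] at h ⊢
  obtain ⟨A, hmono, hA⟩ := h
  refine ⟨fun n => Prod.fst ⁻¹' A n, fun m n hmn => preimage_mono (hmono hmn), fun B => ?_⟩
  refine (hA _).trans (exists_congr fun n => ⟨fun h => ?_, fun h s hs => ?_⟩)
  · rintro ⟨s, x⟩ hx
    exact h (nonempty_iff_ne_empty.mp ⟨x, hx⟩)
  · obtain ⟨x, hx⟩ := nonempty_iff_ne_empty.mpr hs
    exact h hx

lemma isIsomorphic_finiteIdeal {I : SetIdeal ℕ} {A : ℕ → Set ℕ}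
    (hA : ∀ B, B ∈ I.sets ↔ ∃ n, B ⊆ A n) (hfin : ∀ n, (A n).Finite) :
    I.IsIsomorphic finiteIdeal :=
  ⟨Equiv.refl ℕ, fun B => ⟨fun hB => by
    obtain ⟨n, hn⟩ := (hA B).mp hB
    exact (hfin n).subset hn, fun hB => I.finite_mem B hB⟩⟩

/-- Modulo finite sets, `A N` is the largest member of `I`: membership of `B` only asks that `B \ A
N` be finite. Thus `A N` plays the summand `𝒫(ω)` and its complement the summand `Fin`. -/
lemma isIsomorphic_sumPowerset {I : SetIdeal ℕ} {A : ℕ → Set ℕ}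
    (hA : ∀ B, B ∈ I.sets ↔ ∃ n, B ⊆ A n) {N : ℕ} (hN : (A N).Infinite)
    (hfin : ∀ n, (A n \ A N).Finite) :
    I.IsIsomorphic finiteIdeal.sumPowerset := by
  have hAN : A N ∈ I.sets := (hA _).mpr ⟨N, Subset.rfl⟩
  have hco : ((A N)ᶜ).Infinite := fun h =>
    I.univ_notMem (by simpa using I.union_mem _ _ hAN (I.finite_mem _ h))
  classical
  have := hN.to_subtype
  have := hco.to_subtype
  have e₁ : ℕ ≃ ↥((A N)ᶜ) := (nonempty_equiv_of_countable (α := ℕ)).some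
  have e₂ : ℕ ≃ ↥(A N) := (nonempty_equiv_of_countable (α := ℕ)).some
  refine ⟨(Equiv.sumCongr e₁ e₂).trans ((Equiv.sumComm _ _).trans (Equiv.Set.sumCompl (A N))),
    fun B => ?_⟩
  have key : (Sum.inl ⁻¹' (((Equiv.sumCongr e₁ e₂).trans
      ((Equiv.sumComm _ _).trans (Equiv.Set.sumCompl (A N)))) ⁻¹' B) : Set ℕ)
      = (fun i => (e₁ i : ℕ)) ⁻¹' B := by
    ext i; simp
  change _ ↔ (Sum.inl ⁻¹' _ : Set ℕ).Finite
  rw [key]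
  have himg : (fun i => (e₁ i : ℕ)) '' ((fun i => (e₁ i : ℕ)) ⁻¹' B) = B \ A N := by
    rw [image_preimage_eq_inter_range]
    congr 1
    ext x
    constructor
    · rintro ⟨i, rfl⟩; exact (e₁ i).2
    · exact fun hx => ⟨e₁.symm ⟨x, hx⟩, by simp⟩
  have hinj : Function.Injective (fun i => (e₁ i : ℕ)) :=
    Subtype.val_injective.comp e₁.injective
  rw [← finite_image_iff hinj.injOn, himg]
  constructor
  · intro hB
    obtain ⟨n, hn⟩ := (hA B).mp hB
    exact (hfin n).subset (sdiff_subset_sdiff_left hn)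
  · intro hB
    refine I.subset_mem _ _ ?_ (I.union_mem _ _ hAN (I.finite_mem _ hB))
    simp

/-- The ideal of the sets on which a function with infinite fibers takes finitely many
values is isomorphic to `Fin ⊗ {∅}`. -/
lemma isIsomorphic_prodEmpty {I : SetIdeal ℕ} (b : ℕ → ℕ) (hb : ∀ i, (b ⁻¹' {i}).Infinite)
    (hI : ∀ B, B ∈ I.sets ↔ (b '' B).Finite) : I.IsIsomorphic finiteIdeal.prodEmpty := by
  have e : ∀ i, Nonempty (ℕ ≃ {x // b x = i}) := fun i => by
    have : Infinite {x // b x = i} := (hb i).to_subtype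
    exact nonempty_equiv_of_countable
  let E : ℕ × ℕ ≃ ℕ :=
    ((Equiv.sigmaEquivProd ℕ ℕ).symm.trans (Equiv.sigmaCongrRight fun i => (e i).some)).trans
      (Equiv.sigmaFiberEquiv b)
  have hE : ∀ p, b (E p) = p.1 := fun p => ((e p.1).some p.2).2
  refine ⟨E, fun B => ?_⟩
  rw [hI]
  have : {s : ℕ | {x : ℕ | (s, x) ∈ E ⁻¹' B} ≠ ∅} = b '' B := by
    ext s
    rw [mem_ofPred_eq, ← nonempty_iff_ne_empty]
    constructor
    · rintro ⟨x, hx⟩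
      exact ⟨E (s, x), hx, hE _⟩
    · rintro ⟨y, hy, rfl⟩
      refine ⟨(E.symm y).2, ?_⟩
      have h1 : b y = (E.symm y).1 := by simpa using hE (E.symm y)
      change E (b y, (E.symm y).2) ∈ B
      rw [h1]
      simpa using hy
  change _ ↔ {s : ℕ | {x : ℕ | (s, x) ∈ E ⁻¹' B} ≠ ∅}.Finite
  rw [this]

lemma IsCountablyGenerated.classification {I : SetIdeal ℕ} (h : I.IsCountablyGenerated) :
    I.IsIsomorphic finiteIdeal ∨ I.IsIsomorphic finiteIdeal.sumPowerset ∨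
      I.IsIsomorphic finiteIdeal.prodEmpty := by
  obtain ⟨A, hmono, hA⟩ := (isCountablyGenerated_iff I).mp h
  by_cases h1 : ∀ n, (A n).Finite
  · exact Or.inl (isIsomorphic_finiteIdeal hA h1)
  by_cases h2 : ∃ N, (A N).Infinite ∧ ∀ n, (A n \ A N).Finite
  · obtain ⟨N, hN, hfin⟩ := h2
    exact Or.inr (Or.inl (isIsomorphic_sumPowerset hA hN hfin))
  refine Or.inr (Or.inr ?_)
  push Not at h1 h2
  obtain ⟨N₀, hN₀⟩ := h1
  have hinf : ∀ n, N₀ ≤ n → (A n).Infinite := fun n hn => hN₀.mono (hmono hn)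
  -- The condition `N₀ ≤ n` sits inside the existential so that `next` is a total function; its
  -- values below `N₀` play no role.
  have hnext : ∀ n, ∃ m, N₀ ≤ n → n < m ∧ (A m \ A n).Infinite := by
    intro n
    by_cases hn : N₀ ≤ n
    · obtain ⟨m, hm⟩ := h2 n (hinf n hn)
      refine ⟨m, fun _ => ⟨?_, hm⟩⟩
      by_contra hlt
      rw [sdiff_eq_empty.mpr (hmono (not_lt.mp hlt))] at hm
      exact hm finite_empty
    · exact ⟨0, fun h => absurd h hn⟩
  choose next hnext using hnext
  let k : ℕ → ℕ := fun i => next^[i] N₀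
  have hk0 : ∀ i, N₀ ≤ k i := by
    intro i
    induction i with
    | zero => exact le_rfl
    | succ i ih =>
      simp only [k, Function.iterate_succ_apply']
      exact ih.trans (hnext _ ih).1.le
  have hks : ∀ i, k (i + 1) = next (k i) := fun i => Function.iterate_succ_apply' _ _ _
  have hkmono : StrictMono k := strictMono_nat_of_lt_succ fun i => by
    rw [hks]; exact (hnext _ (hk0 i)).1
  have hD : ∀ i, (A (k (i + 1)) \ A (k i)).Infinite := fun i => by
    rw [hks]; exact (hnext _ (hk0 i)).2
  have hex : ∀ x, ∃ i, x ∈ A (k i) := by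
    intro x
    obtain ⟨n, hn⟩ := (hA {x}).mp (I.finite_mem _ (finite_singleton x))
    exact ⟨n, hmono hkmono.le_apply (hn rfl)⟩
  classical
  -- The rank of `x` along the subsequence. Its fibers are `A (k 0)` and the infinite differences `A
  -- (k (i + 1)) \ A (k i)`.
  let b : ℕ → ℕ := fun x => Nat.find (hex x)
  have hb : ∀ x i, b x ≤ i ↔ x ∈ A (k i) := fun x i =>
    ⟨fun h => hmono (hkmono.monotone h) (Nat.find_spec (hex x)), fun h => Nat.find_min' _ h⟩
  refine isIsomorphic_prodEmpty b (fun i => ?_) fun B => ?_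
  · cases i with
    | zero =>
      refine (hinf _ (hk0 0)).mono fun x hx => ?_
      exact Nat.le_zero.mp ((hb x 0).mpr hx)
    | succ i =>
      refine (hD i).mono fun x hx => ?_
      have h1 := (hb x (i + 1)).mpr hx.1
      have h2 := (hb x i).not.mpr hx.2
      change b x = i + 1
      omega
  · rw [hA]
    constructor
    · rintro ⟨n, hn⟩
      refine (finite_Iic n).subset ?_
      rintro _ ⟨x, hx, rfl⟩
      exact (hb x n).mpr (hmono hkmono.le_apply (hn hx))
    · intro h
      obtain ⟨n, hn⟩ := h.bddAbove
      exact ⟨k n, fun x hx => (hb x n).mp (hn (mem_image_of_mem b hx))⟩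

lemma isCountablyGenerated_of_isIsomorphic {I : SetIdeal ℕ}
    (h : I.IsIsomorphic finiteIdeal ∨ I.IsIsomorphic finiteIdeal.sumPowerset ∨
      I.IsIsomorphic finiteIdeal.prodEmpty) : I.IsCountablyGenerated := by
  rcases h with h | h | h
  · exact h.isCountablyGenerated finiteIdeal_isCountablyGenerated
  · exact h.isCountablyGenerated finiteIdeal_isCountablyGenerated.sumPowerset
  · exact h.isCountablyGenerated finiteIdeal_isCountablyGenerated.prodEmpty

end SetIdeal

/-! ### Egorov's theorem for countably generated ideals. -/

namespace SetIdeal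

lemma exists_forall_notMem_lt {X : Type*} {I : SetIdeal ℕ} {A : ℕ → Set ℕ}
    (hA : ∀ B, B ∈ I.sets ↔ ∃ n, B ⊆ A n) {f : ℕ → X → ℝ} {g : X → ℝ}
    (hfg : I.PointwiseConvergesTo f g) {ε : ℝ} (hε : 0 < ε) (x : X) :
    ∃ n, ∀ k ∉ A n, |f k x - g x| < ε := by
  obtain ⟨n, hn⟩ := (hA _).mp (hfg x _ Metric.isOpen_ball (Metric.mem_ball_self hε))
  refine ⟨n, fun k hk => ?_⟩
  by_contra h
  exact hk (hn fun hball => h (by simpa [Real.dist_eq] using hball))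

/-- For each accuracy, a single exceptional set `A (n i)` serves all points of `M`. -/
lemma uniformlyConvergesTo_of_forall {X : Type*} {I : SetIdeal ℕ} {A : ℕ → Set ℕ}
    (hA : ∀ B, B ∈ I.sets ↔ ∃ n, B ⊆ A n) {f : ℕ → X → ℝ} {g : X → ℝ} (M : Set X) (n : ℕ → ℕ)
    (h : ∀ x ∈ M, ∀ i, ∀ k ∉ A (n i), |f k x - g x| < 1 / ((i : ℝ) + 1)) :
    I.UniformlyConvergesTo (fun n => M.domRestrict (f n)) (M.domRestrict g) := by
  intro ε hε
  obtain ⟨i, hi⟩ := exists_nat_one_div_lt hε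
  refine (hA _).mpr ⟨n i, ?_⟩
  rintro k ⟨⟨x, hx⟩, hk⟩
  by_contra hkA
  exact absurd (hk.trans_lt (h x hx i k hkA)) (not_lt.mpr hi.le)

/-- The Egorov theorem for countably generated ideals. -/
theorem IsCountablyGenerated.isKadetsLeonovEgorov {I : SetIdeal ℕ} (h : I.IsCountablyGenerated) :
    IsKadetsLeonovEgorov.{u} I := by
  obtain ⟨A, hmono, hA⟩ := (isCountablyGenerated_iff I).mp h
  intro X _ μ _ η f g hη hf hg hfg
  let E : ℕ → ℕ → Set X := fun i n => {x | ∀ k ∉ A n, |f k x - g x| < 1 / ((i : ℝ) + 1)}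
  have hEm : ∀ i n, MeasurableSet (E i n) := fun i n => by
    have : E i n = ⋂ k ∈ (A n)ᶜ, {x | |f k x - g x| < 1 / ((i : ℝ) + 1)} := by
      ext x; simp [E]
    rw [this]
    exact MeasurableSet.biInter (to_countable _) fun k _ =>
      measurableSet_lt ((hf k).sub hg).abs measurable_const
  have hE : ∀ i, Tendsto (fun n => μ (E i n)ᶜ) atTop (𝓝 0) := by
    intro i
    have hanti : Antitone fun n => (E i n)ᶜ := fun m n hmn =>
      compl_subset_compl.mpr fun x hx k hk => hx k fun hkm => hk (hmono hmn hkm)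
    have hempty : ⋂ n, (E i n)ᶜ = ∅ := by
      rw [← compl_iUnion, compl_empty_iff, eq_univ_iff_forall]
      exact fun x => mem_iUnion.mpr (exists_forall_notMem_lt hA hfg Nat.one_div_pos_of_nat x)
    have := tendsto_measure_iInter_atTop (μ := μ)
      (fun n => (hEm i n).compl.nullMeasurableSet) hanti ⟨0, measure_ne_top _ _⟩
    rwa [hempty, measure_empty] at this
  obtain ⟨δ, hδ, hδsum⟩ := ENNReal.exists_pos_sum_of_countable'
    (ENNReal.ofReal_pos.mpr hη).ne' ℕ
  choose n hn using fun i => ((hE i).eventually (gt_mem_nhds (hδ i))).exists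
  refine ⟨⋂ i, E i (n i), MeasurableSet.iInter fun i => hEm i _, ?_,
    uniformlyConvergesTo_of_forall hA _ n fun x hx i => mem_iInter.mp hx i⟩
  rw [compl_iInter]
  calc μ (⋃ i, (E i (n i))ᶜ) ≤ ∑' i, μ (E i (n i))ᶜ := measure_iUnion_le _
    _ ≤ ∑' i, δ i := ENNReal.tsum_le_tsum fun i => (hn i).le
    _ ≤ _ := hδsum.le

end SetIdeal

/-! ### Non-measurable functions and cardinal invariants. -/

/-- A non-null set of reals has an affine image whose trace on `[0,1]` has outer measure
arbitrarily close to `1`. -/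
lemma exists_subset_Icc_lt_volume {A : Set ℝ} (hA : volume A ≠ 0) {c : ℝ≥0∞} (hc : c < 1) :
    ∃ A' ⊆ Icc (0 : ℝ) 1, c < volume A' ∧ Cardinal.mk A' ≤ Cardinal.mk A := by
  have hne : NeBot (ae (volume.restrict A)) := ae_neBot.mpr (by simpa using hA)
  -- A density point of `A`: Lebesgue's density theorem holds for outer measure, so `A` need not be
  -- measurable.
  obtain ⟨x, hx⟩ := (Besicovitch.ae_tendsto_measure_inter_div volume A).exists
  obtain ⟨r, hr, hr0⟩ := ((hx.eventually (lt_mem_nhds hc)).and self_mem_nhdsWithin).exists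
  replace hr0 : 0 < r := hr0
  have h2r : 0 < 2 * r := by linarith
  let S := (fun y : ℝ => y + (r - x)) '' (A ∩ Metric.closedBall x r)
  refine ⟨(fun y : ℝ => (2 * r)⁻¹ • y) '' S, ?_, ?_,
    Cardinal.mk_image_le.trans (Cardinal.mk_image_le.trans (Cardinal.mk_le_mk_of_subset
      inter_subset_left))⟩
  · rintro _ ⟨_, ⟨y, ⟨-, hy⟩, rfl⟩, rfl⟩
    rw [Real.closedBall_eq_Icc] at hy
    simp only [smul_eq_mul]
    refine ⟨mul_nonneg (inv_nonneg.mpr h2r.le) (by linarith [hy.1]), ?_⟩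
    rw [inv_mul_le_iff₀ h2r]
    linarith [hy.2]
  · have hS : volume S = volume (A ∩ Metric.closedBall x r) := by
      simp only [S, image_add_right, measure_preimage_add_right]
    rw [image_smul, Measure.addHaar_smul, hS, Module.finrank_self, pow_one,
      abs_of_pos (inv_pos.mpr h2r), ENNReal.ofReal_inv_of_pos h2r]
    rwa [Real.volume_closedBall, ENNReal.div_eq_inv_mul] at hr

lemma exists_bound_of_mk_lt_boundingNumber {F : Set (ℕ → ℕ)}
    (hF : Cardinal.mk F < boundingNumber) : ∃ g : ℕ → ℕ, ∀ f ∈ F, ∀ᶠ n in atTop, f n ≤ g n := by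
  by_contra h
  exact hF.not_ge (csInf_le' ⟨F, h, rfl⟩)

lemma exists_mk_eq_nonNull : ∃ A : Set ℝ, volume A ≠ 0 ∧ Cardinal.mk A = nonNull :=
  csInf_mem (s := {κ | ∃ A : Set ℝ, volume A ≠ 0 ∧ Cardinal.mk A = κ})
    ⟨_, univ, by simp, rfl⟩

namespace SetIdeal

/-- The generalized Egorov theorem for countably generated ideals. -/
theorem IsCountablyGenerated.isGeneralizedEgorov {I : SetIdeal ℕ} (h : I.IsCountablyGenerated)
    (hb : nonNull < boundingNumber) : I.IsGeneralizedEgorov := by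
  obtain ⟨A, hmono, hA⟩ := (isCountablyGenerated_iff I).mp h
  intro η f g hη hfg
  obtain ⟨N, hN, hNcard⟩ := exists_mk_eq_nonNull
  have hc : ENNReal.ofReal (1 - η) < 1 := by
    rw [ENNReal.ofReal_lt_one]; linarith
  obtain ⟨A₀, hA₀, hlt, hcard⟩ := exists_subset_Icc_lt_volume hN hc
  choose n hn using fun (x : Icc (0 : ℝ) 1) (i : ℕ) =>
    exists_forall_notMem_lt hA hfg (Nat.one_div_pos_of_nat (α := ℝ) (n := i)) x
  let S : Set (Icc (0 : ℝ) 1) := {x | (x : ℝ) ∈ A₀}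
  have hS : Subtype.val '' S = A₀ := by
    ext x; exact ⟨by rintro ⟨y, hy, rfl⟩; exact hy, fun hx => ⟨⟨x, hA₀ hx⟩, hx, rfl⟩⟩
  have hSn : Cardinal.mk (n '' S) < boundingNumber :=
    lt_of_le_of_lt (Cardinal.mk_image_le.trans
      ((Cardinal.mk_image_eq Subtype.val_injective (s := S)).ge.trans
        (by rw [hS]; exact hcard.trans hNcard.le))) hb
  obtain ⟨G, hG⟩ := exists_bound_of_mk_lt_boundingNumber hSn
  -- Adding a constant turns eventual domination into domination everywhere, so these sets exhaust
  -- `S`.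
  let M : ℕ → Set (Icc (0 : ℝ) 1) := fun m => {x ∈ S | ∀ i, n x i ≤ G i + m}
  have hM : Monotone fun m => Subtype.val '' M m := fun m m' hmm =>
    image_mono fun x hx => ⟨hx.1, fun i => (hx.2 i).trans (by omega)⟩
  have hMU : ⋃ m, Subtype.val '' M m = A₀ := by
    rw [← image_iUnion, ← hS]
    congr 1
    ext x
    refine ⟨fun hx => (mem_iUnion.mp hx).choose_spec.1, fun hx => ?_⟩
    obtain ⟨j, hj⟩ := eventually_atTop.mp (hG _ (mem_image_of_mem n hx))
    refine mem_iUnion.mpr ⟨(Finset.range j).sup (n x), hx, fun i => ?_⟩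
    rcases lt_or_ge i j with hi | hi
    · exact (Finset.le_sup (Finset.mem_range.mpr hi)).trans (Nat.le_add_left _ _)
    · exact (hj i hi).trans (Nat.le_add_right _ _)
  -- Continuity from below along an increasing sequence is valid for outer measure.
  rw [← hMU, hM.measure_iUnion] at hlt
  obtain ⟨m, hm⟩ := lt_iSup_iff.mp hlt
  exact ⟨M m, hm.le, uniformlyConvergesTo_of_forall hA _ (fun i => G i + m)
    fun x hx i k hk => hn x i k fun hkA => hk (hmono (hx.2 i) hkA)⟩

end SetIdeal

/-! ### Countable covers and the tree of large nodes. -/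

namespace SetIdeal

/-- The family `𝒞` is covered by countably many principal ideals `𝒫(A)` with `A ∈ I`. -/
def CountablyCovers (I : SetIdeal ℕ) (𝒞 : Set (Set ℕ)) : Prop :=
  ∃ 𝒜 : Set (Set ℕ), 𝒜.Countable ∧ 𝒜 ⊆ I.sets ∧ ∀ B ∈ 𝒞, ∃ A ∈ 𝒜, B ⊆ A

lemma CountablyCovers.mono {I : SetIdeal ℕ} {𝒞 𝒟 : Set (Set ℕ)} (h : I.CountablyCovers 𝒟)
    (hsub : 𝒞 ⊆ 𝒟) : I.CountablyCovers 𝒞 := by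
  obtain ⟨𝒜, h1, h2, h3⟩ := h
  exact ⟨𝒜, h1, h2, fun B hB => h3 B (hsub hB)⟩

lemma CountablyCovers.iUnion {I : SetIdeal ℕ} {ι : Type*} [Countable ι] {𝒞 : ι → Set (Set ℕ)}
    (h : ∀ i, I.CountablyCovers (𝒞 i)) : I.CountablyCovers (⋃ i, 𝒞 i) := by
  choose 𝒜 h1 h2 h3 using h
  refine ⟨⋃ i, 𝒜 i, countable_iUnion h1, iUnion_subset h2, fun B hB => ?_⟩
  obtain ⟨i, hi⟩ := mem_iUnion.mp hB
  obtain ⟨A, hA, hBA⟩ := h3 i B hi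
  exact ⟨A, mem_iUnion.mpr ⟨i, hA⟩, hBA⟩

lemma CountablyCovers.union {I : SetIdeal ℕ} {𝒞 𝒟 : Set (Set ℕ)} (h : I.CountablyCovers 𝒞)
    (h' : I.CountablyCovers 𝒟) : I.CountablyCovers (𝒞 ∪ 𝒟) := by
  obtain ⟨𝒜, h1, h2, h3⟩ := h
  obtain ⟨ℬ, h1', h2', h3'⟩ := h'
  refine ⟨𝒜 ∪ ℬ, h1.union h1', union_subset h2 h2', fun B hB => ?_⟩
  rcases hB with hB | hB
  · obtain ⟨A, hA, h⟩ := h3 B hB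
    exact ⟨A, Or.inl hA, h⟩
  · obtain ⟨A, hA, h⟩ := h3' B hB
    exact ⟨A, Or.inr hA, h⟩

lemma countablyCovers_powerset {I : SetIdeal ℕ} {A : Set ℕ} (hA : A ∈ I.sets) :
    I.CountablyCovers (𝒫 A) :=
  ⟨{A}, countable_singleton A, by simpa using hA, fun _ hB => ⟨A, rfl, hB⟩⟩

lemma CountablyCovers.isCountablyGenerated {I : SetIdeal ℕ} (h : I.CountablyCovers I.sets) :
    I.IsCountablyGenerated := by
  obtain ⟨𝒜, h1, h2, h3⟩ := h
  refine ⟨𝒜, h1, h2, fun B hB => ?_⟩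
  obtain ⟨A, hA, hBA⟩ := h3 B hB
  exact ⟨{A}, by simpa using hA, finite_singleton A, by simpa using hBA⟩

/-- The members of `𝒞` whose restriction to `{0, …, t.1 - 1}` is `t.2`. -/
def cylinder (𝒞 : Set (Set ℕ)) (t : ℕ × Finset ℕ) : Set (Set ℕ) :=
  {B ∈ 𝒞 | B ∩ Iio t.1 = ↑t.2}

/-- The cylinders of `𝒞` that are not countably covered. -/
def LargeNode (I : SetIdeal ℕ) (𝒞 : Set (Set ℕ)) : Type :=
  {t : ℕ × Finset ℕ // ¬ I.CountablyCovers (cylinder 𝒞 t)}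

instance (I : SetIdeal ℕ) (𝒞 : Set (Set ℕ)) : Countable (LargeNode I 𝒞) :=
  inferInstanceAs (Countable {t : ℕ × Finset ℕ // ¬ I.CountablyCovers (cylinder 𝒞 t)})

namespace LargeNode

variable {I : SetIdeal ℕ} {𝒞 : Set (Set ℕ)}

/-- `t` is properly extended by `t'`, which contains `a`. -/
def ExtendsBy (t : LargeNode I 𝒞) (a : ℕ) (t' : LargeNode I 𝒞) : Prop :=
  t.1.1 < t'.1.1 ∧ t.1.2 ⊆ t'.1.2 ∧ a ∈ t'.1.2

/-- The union of all proper extensions of `t`. -/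
def succs (t : LargeNode I 𝒞) : Set ℕ := {a | ∃ t', t.ExtendsBy a t'}

/-- A set in the cylinder of `t` either lies in `t.succs` or has a point `a` outside it. In the
second case its initial segment past `a` cannot be a large node. There are only countably many
segments, so `t.succs ∈ I` would make the whole cylinder countably covered. -/
lemma succs_notMem (t : LargeNode I 𝒞) : t.succs ∉ I.sets := by
  intro hU
  apply t.2
  let S := {t' : ℕ × Finset ℕ // I.CountablyCovers (cylinder 𝒞 t')}
  refine ((countablyCovers_powerset hU).union
    (CountablyCovers.iUnion (fun t' : S => t'.2))).mono ?_
  rintro B ⟨hB, hBt⟩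
  by_cases hsub : B ⊆ t.succs
  · exact Or.inl hsub
  right
  obtain ⟨a, haB, ha⟩ := not_subset.mp hsub
  set n := max (t.1.1 + 1) (a + 1) with hn
  have hfin : (B ∩ Iio n).Finite := (finite_Iio n).subset inter_subset_right
  have hmem : B ∈ cylinder 𝒞 (n, hfin.toFinset) := ⟨hB, by simp⟩
  have hgood : I.CountablyCovers (cylinder 𝒞 (n, hfin.toFinset)) := by
    by_contra hbad
    refine ha ⟨⟨(n, hfin.toFinset), hbad⟩, ?_, ?_, ?_⟩
    · change t.1.1 < n
      omega
    · intro i hi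
      have hi' : i ∈ B ∩ Iio t.1.1 := by rw [hBt]; exact hi
      have hlt : i < t.1.1 := hi'.2
      have : i < n := by omega
      change i ∈ hfin.toFinset
      simpa using ⟨hi'.1, this⟩
    · have : a < n := by omega
      change a ∈ hfin.toFinset
      simpa using ⟨haB, this⟩
  exact mem_iUnion.mpr ⟨⟨_, hgood⟩, hmem⟩

end LargeNode

end SetIdeal

/-! ### Random branches and the failure of Egorov's theorem. -/

/-- If `φ(U) = ∞` for a non-pathological `φ`, points of `U` can be chosen at random so that sets
of finite `φ`-value are rarely hit. -/
lemma IsNonPathologicalSubmeasure.exists_measurable_selection {φ : Set ℕ → ℝ≥0∞}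
    (hφ : IsSubmeasure φ) (hnp : IsNonPathologicalSubmeasure φ) {U : Set ℕ} (hU : φ U = ∞)
    {ε : ℝ≥0∞} (hε : ε ≠ 0) :
    ∃ q : unitInterval → ℕ, Measurable q ∧ (∀ u, q u ∈ U) ∧
      ∀ W, volume (q ⁻¹' W) ≤ ε * φ W := by
  obtain ⟨L, hL0, hLε⟩ : ∃ L : ℝ≥0∞, L ≠ ∞ ∧ L⁻¹ ≤ ε := ⟨ε⁻¹, by simpa using hε, by simp⟩
  obtain ⟨μ, hμ, hLμ⟩ : ∃ μ : Measure ℕ, (∀ B, μ B ≤ φ B) ∧ L < μ U := by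
    have h : L < ⨆ (μ : Measure ℕ) (_ : ∀ B : Set ℕ, μ B ≤ φ B), μ U := by
      rw [← hnp U, hU]; exact lt_top_iff_ne_top.mpr hL0
    simpa only [lt_iSup_iff, exists_prop] using h
  have hmono : Monotone fun n : ℕ => U ∩ Iio n := fun m n hmn =>
    inter_subset_inter_right _ (Iio_subset_Iio hmn)
  have hUnion : ⋃ n : ℕ, U ∩ Iio n = U := by
    rw [← inter_iUnion, inter_eq_left]
    exact fun x _ => mem_iUnion.mpr ⟨x + 1, Nat.lt_succ_self x⟩
  obtain ⟨n, hn⟩ : ∃ n : ℕ, L < μ (U ∩ Iio n) := by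
    rw [← hUnion, hmono.measure_iUnion] at hLμ
    exact lt_iSup_iff.mp hLμ
  set F := U ∩ Iio n with hF
  have hFfin : F.Finite := (finite_Iio n).subset inter_subset_right
  have hFtop : μ F ≠ ∞ := by
    have h1 : μ F = ∑ i ∈ hFfin.toFinset, μ {i} := by
      rw [sum_measure_singleton]; simp
    rw [h1]
    exact ENNReal.sum_ne_top.mpr fun i _ => ((hμ _).trans_lt (hφ.singleton_lt_top i)).ne
  have hF0 : μ F ≠ 0 := (bot_le.trans_lt hn).ne'
  -- Normalizing by `μ F > L` divides the bound `μ W ≤ φ W` by more than `L`; finiteness of `F`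
  -- makes `μ F` finite.
  let ν : Measure ℕ := ProbabilityTheory.cond μ F
  have hν : IsProbabilityMeasure ν :=
    ProbabilityTheory.cond_isProbabilityMeasure_of_finite hF0 hFtop
  obtain ⟨q, hq, hqν⟩ := ν.exists_measurable_map_eq
  obtain ⟨a, ha⟩ : F.Nonempty := by
    by_contra h
    rw [not_nonempty_iff_eq_empty.mp h] at hF0
    simp at hF0
  classical
  -- `q` lies in `F` only almost surely; `r` moves the exceptional values to `a ∈ F`.
  let r : ℕ → ℕ := fun i => if i ∈ F then i else a
  refine ⟨r ∘ q, (measurable_from_top).comp hq, fun u => ?_, fun W => ?_⟩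
  · simp only [r, Function.comp]
    split_ifs with h
    · exact h.1
    · exact ha.1
  · have h1 : volume ((r ∘ q) ⁻¹' W) = ν (r ⁻¹' W) := by
      rw [← hqν, Measure.map_apply hq (MeasurableSet.of_discrete), preimage_comp]
    have h2 : F ∩ r ⁻¹' W ⊆ W := by
      rintro i ⟨hi, hiW⟩
      simpa [r, hi] using hiW
    rw [h1, ProbabilityTheory.cond_apply (MeasurableSet.of_discrete)]
    refine mul_le_mul' ((ENNReal.inv_le_inv.mpr hn.le).trans hLε) ((measure_mono h2).trans (hμ W))

namespace SetIdeal

/-- An ideal that is not countably generated fails the Egorov theorem on `[0,1]`, even for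
measurable functions and arbitrary sets of large outer measure. -/
theorem exists_not_uniformlyConvergesTo {I : SetIdeal ℕ} {φ : Set ℕ → ℝ≥0∞}
    (hφ : IsSubmeasure φ) (hlsc : IsLscSubmeasure φ) (hnp : IsNonPathologicalSubmeasure φ)
    (hI : I.sets = {A | φ A < ∞}) (hgen : ¬ I.IsCountablyGenerated) :
    ∃ f : ℕ → unitInterval → ℝ, (∀ n, Measurable (f n)) ∧
      I.PointwiseConvergesTo f 0 ∧
      ∀ M : Set unitInterval,
        {n | ∃ x ∈ M, 1 ≤ |f n x|} ∈ I.sets → volume M < ENNReal.ofReal (1 / 2) := by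
  have hmono : ∀ A B : Set ℕ, A ⊆ B → φ A ≤ φ B := fun A B h => by
    simpa [union_eq_self_of_subset_left h] using hφ.le_union A B
  obtain ⟨k, hk⟩ : ∃ k : ℕ, ¬ I.CountablyCovers {A | φ A ≤ k} := by
    by_contra! h
    refine hgen (((CountablyCovers.iUnion h).mono ?_).isCountablyGenerated)
    intro A hA
    rw [hI] at hA
    obtain ⟨k, hk⟩ := ENNReal.exists_nat_gt (LT.lt.ne hA)
    exact mem_iUnion.mpr ⟨k, hk.le⟩
  set 𝒞 : Set (Set ℕ) := {A | φ A ≤ k}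
  let T := LargeNode I 𝒞
  let t₀ : T := ⟨(0, ∅), fun h => hk (h.mono fun B hB => ⟨hB, by ext; simp⟩)⟩
  have hT : ∀ t : T, φ t.1.2 ≤ k := by
    intro t
    obtain ⟨B, hB, hBt⟩ : (cylinder 𝒞 t.1).Nonempty := by
      by_contra h
      refine t.2 ⟨∅, countable_empty, empty_subset _, fun B hB => ?_⟩
      rw [not_nonempty_iff_eq_empty.mp h] at hB
      exact hB.elim
    rw [← hBt]
    exact (hmono _ _ inter_subset_left).trans hB
  have hU : ∀ t : T, φ t.succs = ∞ := by
    intro t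
    have h := t.succs_notMem
    rw [hI] at h
    simpa using h
  obtain ⟨ε, hε, hεsum⟩ := ENNReal.exists_pos_sum_of_countable' one_ne_zero T
  choose q hq hqU hqW using fun t : T =>
    hnp.exists_measurable_selection hφ (hU t) (hε t).ne'
  -- The default value `t` is never used, since `q t` takes values in `t.succs`.
  have hstep : ∀ (t : T) (a : ℕ), ∃ t' : T, a ∈ t.succs → t.ExtendsBy a t' := by
    intro t a
    by_cases h : a ∈ t.succs
    · exact ⟨h.choose, fun _ => h.choose_spec⟩
    · exact ⟨t, fun h' => absurd h' h⟩
  choose step hstep using hstep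
  let t : ℕ → unitInterval → T := fun j u => (fun s => step s (q s u))^[j] t₀
  have ht : ∀ j u, t (j + 1) u = step (t j u) (q (t j u) u) := fun j u =>
    Function.iterate_succ_apply' _ _ _
  have hext : ∀ j u, (t j u).ExtendsBy (q (t j u) u) (t (j + 1) u) := fun j u => by
    rw [ht]; exact hstep _ _ (hqU _ _)
  have hlen : ∀ j u, j ≤ (t j u).1.1 := by
    intro j u
    induction j with
    | zero => exact Nat.zero_le _
    | succ j ih => exact Nat.succ_le_of_lt (ih.trans_lt (hext j u).1)
  have hsmono : ∀ u, Monotone fun j => (t j u).1.2 := fun u =>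
    monotone_nat_of_le_succ fun j => (hext j u).2.1
  let _ : MeasurableSpace T := ⊤
  have htm : ∀ j, Measurable (t j) := by
    intro j
    induction j with
    | zero => exact measurable_const
    | succ j ih =>
      have h1 : Measurable fun p : T × unitInterval => q p.1 p.2 :=
        measurable_from_prod_countable_right fun s => hq s
      have h2 : Measurable fun p : T × ℕ => step p.1 p.2 :=
        measurable_from_prod_countable_right fun s => measurable_from_top
      have h3 : Measurable fun u => q (t j u) u := h1.comp (ih.prodMk measurable_id)
      have h4 : t (j + 1) = fun u => step (t j u) (q (t j u) u) := funext (ht j)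
      rw [h4]
      exact h2.comp (ih.prodMk h3)
  let C : unitInterval → Set ℕ := fun u => ⋃ j, ((t j u).1.2 : Set ℕ)
  -- Each finite part of `C u` lies in a single node, of `φ`-value at most `k`; lower semicontinuity
  -- passes this bound to `C u`.
  have hCI : ∀ u, C u ∈ I.sets := by
    intro u
    rw [hI]
    refine lt_of_le_of_lt (le_of_tendsto (hlsc (C u)) (Eventually.of_forall fun n => ?_))
      (ENNReal.natCast_lt_top k)
    have hfin : (C u ∩ Iio n).Finite := (finite_Iio n).subset inter_subset_right
    obtain ⟨j, hj⟩ : ∃ j, C u ∩ Iio n ⊆ ((t j u).1.2 : Set ℕ) := by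
      have hdir : Directed (· ⊆ ·) fun j => ((t j u).1.2 : Set ℕ) :=
        Monotone.directed_le fun i j hij => Finset.coe_subset.mpr (hsmono u hij)
      obtain ⟨j, hj⟩ := hdir.exists_mem_subset_of_finset_subset_biUnion
        (s := hfin.toFinset) (by rw [hfin.coe_toFinset]; exact inter_subset_left)
      exact ⟨j, by rwa [hfin.coe_toFinset] at hj⟩
    exact (hmono _ _ hj).trans (hT _)
  have hCm : ∀ n, MeasurableSet {u | n ∈ C u} := by
    intro n
    have : {u | n ∈ C u} = ⋃ j, t j ⁻¹' {s | n ∈ s.1.2} := by ext u; simp [C]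
    rw [this]
    exact MeasurableSet.iUnion fun j => htm j trivial
  classical
  have hf : ∀ (n : ℕ) (u : unitInterval),
      ({u | n ∈ C u} : Set unitInterval).indicator (1 : unitInterval → ℝ) u
        = if n ∈ C u then 1 else 0 := fun n u => by
    simp [indicator_apply]
  refine ⟨fun n => ({u | n ∈ C u} : Set unitInterval).indicator 1,
    fun n => measurable_one.indicator (hCm n), fun u V _ hV => ?_, fun M hM => ?_⟩
  · refine I.subset_mem _ _ ?_ (hCI u)
    intro n hn
    by_contra hnC
    refine hn ?_
    change ({u | n ∈ C u} : Set unitInterval).indicator (1 : unitInterval → ℝ) u ∈ V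
    rw [hf, if_neg hnC]
    exact hV
  · set W := {n | ∃ x ∈ M, 1 ≤ |({u | n ∈ C u} : Set unitInterval).indicator
      (1 : unitInterval → ℝ) x|} with hW
    have hCW : ∀ u ∈ M, C u ⊆ W := fun u hu n hn => ⟨u, hu, by rw [hf, if_pos hn]; simp⟩
    have hWfin : φ W ≠ ∞ := by
      rw [hI] at hM
      exact LT.lt.ne hM
    have htail : ∑' s : T, ε s * φ W ≠ ∞ := by
      rw [ENNReal.tsum_mul_right]
      exact ENNReal.mul_ne_top (hεsum.trans ENNReal.one_lt_top).ne hWfin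
    -- The `ε s` were chosen before `M`, but finiteness of `φ W` makes some tail small. No
    -- independence of the `q s` is needed.
    obtain ⟨F, hF⟩ := ((ENNReal.tendsto_tsum_compl_atTop_zero htail).eventually
      (gt_mem_nhds (show (0 : ℝ≥0∞) < ENNReal.ofReal (1 / 2) by simp))).exists
    obtain ⟨j, hj⟩ : ∃ j, ∀ s ∈ F, s.1.1 < j :=
      ⟨F.sup (fun s => s.1.1) + 1, fun s hs =>
        Nat.lt_succ_of_le (Finset.le_sup (f := fun s : T => s.1.1) hs)⟩
    have hcover : M ⊆ ⋃ s : {s // s ∉ F}, q s.1 ⁻¹' W := by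
      intro u hu
      have hnot : t j u ∉ F := fun h => absurd (hj _ h) (not_lt.mpr (hlen j u))
      refine mem_iUnion.mpr ⟨⟨t j u, hnot⟩, hCW u hu ?_⟩
      exact mem_iUnion.mpr ⟨j + 1, (hext j u).2.2⟩
    calc volume M ≤ volume (⋃ s : {s // s ∉ F}, q s.1 ⁻¹' W) := measure_mono hcover
      _ ≤ ∑' s : {s // s ∉ F}, volume (q s.1 ⁻¹' W) := measure_iUnion_le _
      _ ≤ ∑' s : {s // s ∉ F}, ε s.1 * φ W := ENNReal.tsum_le_tsum fun s => hqW s.1 W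
      _ < _ := hF

end SetIdeal

/-! ### Egorov properties force countable generation. -/

namespace SetIdeal

theorem IsGeneralizedEgorov.isCountablyGenerated {I : SetIdeal ℕ}
    (hI : I.IsNonPathologicalSigma02) (h : I.IsGeneralizedEgorov) : I.IsCountablyGenerated := by
  obtain ⟨-, φ, hφ, hlsc, hnp, hIφ⟩ := hI
  by_contra hgen
  obtain ⟨f, -, hconv, hbad⟩ := exists_not_uniformlyConvergesTo hφ hlsc hnp hIφ hgen
  obtain ⟨M, hM, hunif⟩ := h (1 / 2) f 0 (by norm_num) hconv
  have hvol : volume M = volume ((fun x : Icc (0 : ℝ) 1 => (x : ℝ)) '' M) :=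
    (MeasurableEmbedding.subtype_coe measurableSet_Icc).comap_apply _ _
  refine absurd (hbad M (I.subset_mem _ _ ?_ (hunif 1 one_pos))) (not_lt.mpr ?_)
  · rintro n ⟨x, hx, h1⟩
    exact ⟨⟨x, hx⟩, by simpa [Set.domRestrict] using h1⟩
  · rw [hvol]
    norm_num at hM ⊢
    exact hM

theorem IsKadetsLeonovEgorov.isCountablyGenerated {I : SetIdeal ℕ}
    (hI : I.IsNonPathologicalSigma02) (h : IsKadetsLeonovEgorov.{u} I) :
    I.IsCountablyGenerated := by
  obtain ⟨-, φ, hφ, hlsc, hnp, hIφ⟩ := hI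
  by_contra hgen
  obtain ⟨f, hf, hconv, hbad⟩ := exists_not_uniformlyConvergesTo hφ hlsc hnp hIφ hgen
  -- The counterexample lives on `[0,1]`; `ULift` transports it to the universe of the hypothesis.
  obtain ⟨M, hMm, hM, hunif⟩ := h (ULift.{u} unitInterval) (Measure.map ULift.up volume) (1 / 2)
    (fun n x => f n x.down) 0 (by norm_num) (fun n => (hf n).comp measurable_down)
    measurable_zero (fun x => hconv x.down)
  have hMm' : MeasurableSet (ULift.up ⁻¹' M : Set unitInterval) := measurable_up hMm
  rw [Measure.map_apply measurable_up hMm.compl, preimage_compl, prob_compl_eq_one_sub hMm'] at hM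
  have hlt := hbad (ULift.up ⁻¹' M) (I.subset_mem _ _ ?_ (hunif 1 one_pos))
  · refine absurd (tsub_le_iff_right.mp hM) (not_le.mpr ?_)
    calc ENNReal.ofReal (1 / 2) + volume (ULift.up ⁻¹' M : Set unitInterval)
        < ENNReal.ofReal (1 / 2) + ENNReal.ofReal (1 / 2) :=
          ENNReal.add_lt_add_left ENNReal.ofReal_ne_top hlt
      _ = 1 := by rw [← ENNReal.ofReal_add (by norm_num) (by norm_num)]; norm_num
  · rintro n ⟨x, hx, h1⟩
    exact ⟨⟨ULift.up x, hx⟩, by simpa [Set.domRestrict] using h1⟩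

end SetIdeal

theorem mainTheorem2 (I : SetIdeal ℕ) (hI : I.IsNonPathologicalSigma02) :
    List.TFAE [
      SetIdeal.IsKadetsLeonovEgorov.{u} I,
      I.IsCountablyGenerated,
      I.IsIsomorphic SetIdeal.finiteIdeal ∨
        I.IsIsomorphic SetIdeal.finiteIdeal.sumPowerset ∨
        I.IsIsomorphic SetIdeal.finiteIdeal.prodEmpty] ∧
    (I.IsGeneralizedEgorov → I.IsCountablyGenerated) ∧
    (nonNull < boundingNumber →
      List.TFAE [
        SetIdeal.IsKadetsLeonovEgorov.{u} I,
        I.IsGeneralizedEgorov,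
        I.IsCountablyGenerated,
        I.IsIsomorphic SetIdeal.finiteIdeal ∨
          I.IsIsomorphic SetIdeal.finiteIdeal.sumPowerset ∨
          I.IsIsomorphic SetIdeal.finiteIdeal.prodEmpty]) := by
  have hac : SetIdeal.IsKadetsLeonovEgorov.{u} I ↔ I.IsCountablyGenerated :=
    ⟨fun h => h.isCountablyGenerated hI, fun h => h.isKadetsLeonovEgorov⟩
  have hcd : I.IsCountablyGenerated ↔ (I.IsIsomorphic SetIdeal.finiteIdeal ∨
      I.IsIsomorphic SetIdeal.finiteIdeal.sumPowerset ∨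
      I.IsIsomorphic SetIdeal.finiteIdeal.prodEmpty) :=
    ⟨fun h => h.classification, SetIdeal.isCountablyGenerated_of_isIsomorphic⟩
  have hbc : I.IsGeneralizedEgorov → I.IsCountablyGenerated := fun h => h.isCountablyGenerated hI
  refine ⟨?_, hbc, fun hlt => ?_⟩
  · tfae_have 1 ↔ 2 := hac
    tfae_have 2 ↔ 3 := hcd
    tfae_finish
  · tfae_have 1 ↔ 3 := hac
    tfae_have 2 ↔ 3 := ⟨hbc, fun h => h.isGeneralizedEgorov hlt⟩
    tfae_have 3 ↔ 4 := hcd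
    tfae_finish
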